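/- Let $d\ge 1$ and $0\le k\le d$ be integers, and write $\mathbb{R}^d=\mathbb{R}^{d-k}\times\mathbb{R}^k$ with the Euclidean norm $|\cdot|$. Let $\sigma$ be the usual surface measure on the unit sphere $\mathbb{S}^{d-1}\subset\mathbb{R}^d$, so that $\|F\|_{L^2(\mathbb{S}^{d-1})}^2=\int_{\mathbb{S}^{d-1}}|F|^2\,d\sigma$. Let $G_k=O(d-k)\times O(k)$ act on $\mathbb{R}^d$ by $(A,B)(y,z)=(Ay,Bz)$. A function $F\in L^2(\mathbb{S}^{d-1})$ (complex-valued) is called $G_k$-symmetric if $F\circ T=F$ in $L^2(\mathbb{S}^{d-1})$ (that is, $\sigma$-almost everywhere) for every $T\in G_k$. For $F\in L^2(\mathbb{S}^{d-1})$ and $x\in\mathbb{R}^d$ put $$\widehat{F\sigma}(x)=\int_{\mathbb{S}^{d-1}}F(\omega)\,e^{i x\cdot\omega}\,d\sigma(\omega).$$ (a) There is a constant $C=C_{k,d}<\infty$, depending only on $k$ and $d$, such that $$|\widehat{F\sigma}(y,z)|\le C\,\|F\|_{L^2(\mathbb{S}^{d-1})}\,(1+|y|)^{\frac{k+1-d}{2}}\,(1+|z|)^{\frac{1-k}{2}}$$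 for every $G_k$-symmetric $F\in L^2(\mathbb{S}^{d-1})$ and every $(y,z)\in\mathbb{R}^{d-k}\times\mathbb{R}^k$. (b) Suppose moreover that $d\ge 4$ and $2\le k\le d-2$. Then for every $\varepsilon>0$ there is $R=R(k,d,\varepsilon)<\infty$ such that $|\widehat{F\sigma}(x)|<\varepsilon$ for every $x\in\mathbb{R}^d$ with $|x|>R$ and every $G_k$-symmetric $F\in L^2(\mathbb{S}^{d-1})$ with $\|F\|_{L^2(\mathbb{S}^{d-1})}=1$. -/

import Mathlib

open MeasureTheory Metric
open scoped InnerProductSpace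

noncomputable section

/-- `ℝ^d` written as the orthogonal sum `ℝ^{d-k} × ℝ^k`, with the Euclidean norm
`|(y, z)|² = |y|² + |z|²`, the Borel `σ`-algebra and Lebesgue measure. -/
abbrev BlockSpace (d k : ℕ) : Type :=
  WithLp 2 (EuclideanSpace ℝ (Fin (d - k)) × EuclideanSpace ℝ (Fin k))

/-- The unit sphere `S^{d-1}` of `ℝ^d = ℝ^{d-k} × ℝ^k`. -/
abbrev BlockSphere (d k : ℕ) : Type := sphere (0 : BlockSpace d k) 1

/-- The usual surface measure `σ` on `S^{d-1}`. -/
def surfaceMeasure (d k : ℕ) : Measure (BlockSphere d k) :=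
  (volume : Measure (BlockSpace d k)).toSphere

/-- The orthogonal map `(y, z) ↦ (A y, B z)` of `ℝ^d`, restricted to the unit sphere, for
`A ∈ O(d-k)` and `B ∈ O(k)`. -/
def blockRotate {d k : ℕ}
    (A : EuclideanSpace ℝ (Fin (d - k)) ≃ₗᵢ[ℝ] EuclideanSpace ℝ (Fin (d - k)))
    (B : EuclideanSpace ℝ (Fin k) ≃ₗᵢ[ℝ] EuclideanSpace ℝ (Fin k))
    (ω : BlockSphere d k) : BlockSphere d k :=
  ⟨WithLp.toLp 2 (A ω.1.fst, B ω.1.snd), by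
    have h : ‖ω.1‖ = 1 := mem_sphere_zero_iff_norm.mp ω.2
    rw [WithLp.prod_norm_eq_of_L2] at h
    rw [mem_sphere_zero_iff_norm, WithLp.prod_norm_eq_of_L2]
    simpa using h⟩

/-- `F ∈ L²(S^{d-1})` is `G_k`-symmetric, `G_k = O(d-k) × O(k)`: one has `F ∘ T = F`, as elements
of `L²`, for every `T ∈ G_k`. -/
def IsBlockSymmetric {d k : ℕ} (F : Lp ℂ 2 (surfaceMeasure d k)) : Prop :=
  ∀ (A : EuclideanSpace ℝ (Fin (d - k)) ≃ₗᵢ[ℝ] EuclideanSpace ℝ (Fin (d - k)))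
    (B : EuclideanSpace ℝ (Fin k) ≃ₗᵢ[ℝ] EuclideanSpace ℝ (Fin k)),
    (fun ω => F (blockRotate A B ω)) =ᵐ[surfaceMeasure d k] F

/-- The extension operator `(Fσ)^(x) = ∫ F(ω) e^{i x·ω} dσ(ω)` over `S^{d-1}`. -/
def sphereExtension {d k : ℕ} (F : Lp ℂ 2 (surfaceMeasure d k)) (x : BlockSpace d k) : ℂ :=
  ∫ ω, F ω * Complex.exp (Complex.I * ((⟪x, (ω : BlockSpace d k)⟫_ℝ : ℝ) : ℂ))
    ∂(surfaceMeasure d k)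

end

noncomputable section

/-! Symmetry of F makes its extension a function of |y| and |z| alone
(`IsBlockSymmetric.sphereExtension_congr`). It therefore equals its average over uniformly
distributed frequencies with these block norms. By Fubini the average falls on the plane wave, which
becomes a product of two Fourier transforms of spherical measures, evaluated at the blocks ω₁, ω₂ of
ω (`IsBlockSymmetric.sphereExtension_eq`).

On a block of dimension N ≥ 2 such a transform is O((1+|y||u|)^(-(N-1)/2)). This follows from
Bessel's equation by a monotone energy (`exists_bound_of_bessel_equation`), without special
functions. As |u| ≤ 1, it is at most a constant times |u|^(-(N-1)/2) (1+|y|)^(-(N-1)/2).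

Cauchy–Schwarz in ω then leaves the L² norm of the weight |ω₁|^(-(d-k-1)/2) |ω₂|^(-(k-1)/2), which
is finite because |y|^(-(N-1)) is locally integrable in dimension N. This is (a). For (b), both
exponents in (a) are at most -1/2, so the bound is O(|x|^(-1/2)). -/

/-! ### Isometries acting on the sphere. -/

/-- The restriction of a linear isometric equivalence to the unit sphere. -/
def LinearIsometryEquiv.unitSphereMap {E : Type*} [NormedAddCommGroup E] [NormedSpace ℝ E]
    (L : E ≃ₗᵢ[ℝ] E) (ω : sphere (0 : E) 1) : sphere (0 : E) 1 :=
  ⟨L ω, by simp⟩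

-- `toSphere` measures a set through the volume of the cone over it, and isometries commute with
-- forming cones.
open scoped Pointwise in
theorem measurePreserving_unitSphereMap {E : Type*} [NormedAddCommGroup E] [InnerProductSpace ℝ E]
    [FiniteDimensional ℝ E] [MeasurableSpace E] [BorelSpace E] (L : E ≃ₗᵢ[ℝ] E) :
    MeasurePreserving L.unitSphereMap (volume : Measure E).toSphere
      (volume : Measure E).toSphere := by
  have hm : Measurable L.unitSphereMap :=
    (L.continuous.measurable.comp measurable_subtype_coe).subtype_mk
  refine ⟨hm, Measure.ext fun s hs => ?_⟩
  rw [Measure.map_apply hm hs, Measure.toSphere_apply' _ hs, Measure.toSphere_apply' _ (hm hs)]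
  congr 1
  have hpre : Set.Ioo (0 : ℝ) 1 • ((↑) '' (L.unitSphereMap ⁻¹' s) : Set E)
      = L ⁻¹' (Set.Ioo (0 : ℝ) 1 • ((↑) '' s : Set E)) := by
    ext x
    simp only [Set.mem_smul, Set.mem_preimage, Set.mem_image]
    constructor
    · rintro ⟨r, hr, _, ⟨ω, hω, rfl⟩, rfl⟩
      exact ⟨r, hr, L ω, ⟨L.unitSphereMap ω, hω, rfl⟩, by simp⟩
    · rintro ⟨r, hr, _, ⟨ω, hω, rfl⟩, h⟩
      refine ⟨r, hr, L.symm ω, ⟨L.symm.unitSphereMap ω, ?_, rfl⟩, ?_⟩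
      · have : L.unitSphereMap (L.symm.unitSphereMap ω) = ω := by
          ext; simp [LinearIsometryEquiv.unitSphereMap]
        simpa [this] using hω
      · apply L.injective
        simpa using h
  rw [hpre]
  exact L.measurePreserving.measure_preimage_equiv (f := L.toMeasurableEquiv) _

/-- The reflection in the hyperplane orthogonal to v - w exchanges v and w. -/
theorem exists_linearIsometryEquiv_apply_eq {E : Type*} [NormedAddCommGroup E]
    [InnerProductSpace ℝ E] {v w : E} (h : ‖v‖ = ‖w‖) : ∃ L : E ≃ₗᵢ[ℝ] E, L v = w :=
  ⟨_, Submodule.reflection_sub h⟩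

/-! ### Rotation-invariant measures and Bessel's equation. -/

section SphericalMeasure

variable {E : Type*} [NormedAddCommGroup E] [InnerProductSpace ℝ E]
  [MeasurableSpace E]

/-- A finite measure on `E` carried by the unit sphere and invariant under linear isometries. -/
structure IsSphericalMeasure (μ : Measure E) : Prop where
  map_eq : ∀ L : E ≃ₗᵢ[ℝ] E, μ.map L = μ
  norm_eq : ∀ᵐ ω ∂μ, ‖ω‖ = 1

variable [BorelSpace E] {μ : Measure E}

theorem isSphericalMeasure_map_toSphere [FiniteDimensional ℝ E] :
    IsSphericalMeasure ((volume : Measure E).toSphere.map Subtype.val) where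
  map_eq L := by
    have h := (measurePreserving_unitSphereMap L).map_eq
    have hm := (measurePreserving_unitSphereMap L).measurable
    conv_rhs => rw [← h]
    rw [Measure.map_map L.continuous.measurable measurable_subtype_coe,
      Measure.map_map measurable_subtype_coe hm]
    rfl
  norm_eq := by
    rw [ae_map_iff (by fun_prop) (measurableSet_eq_fun (by fun_prop) (by fun_prop))]
    filter_upwards with ω using by simp

theorem IsSphericalMeasure.integral_comp {G : Type*} [NormedAddCommGroup G] [NormedSpace ℝ G]
    (hμ : IsSphericalMeasure μ) (L : E ≃ₗᵢ[ℝ] E) (f : E → G) :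
    ∫ ω, f (L ω) ∂μ = ∫ ω, f ω ∂μ := by
  conv_rhs => rw [← hμ.map_eq L]
  exact (L.toMeasurableEquiv.measurableEmbedding.integral_map f).symm

theorem IsSphericalMeasure.integral_cos_inner_congr (hμ : IsSphericalMeasure μ) {x y : E}
    (h : ‖x‖ = ‖y‖) : ∫ ω, Real.cos ⟪x, ω⟫_ℝ ∂μ = ∫ ω, Real.cos ⟪y, ω⟫_ℝ ∂μ := by
  obtain ⟨L, rfl⟩ := exists_linearIsometryEquiv_apply_eq h
  rw [← hμ.integral_comp L fun ω => Real.cos ⟪L x, ω⟫_ℝ]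
  simp

variable [FiniteDimensional ℝ E]

theorem IsSphericalMeasure.integral_exp_inner [IsFiniteMeasure μ] (hμ : IsSphericalMeasure μ)
    (x : E) : ∫ ω, Complex.exp (Complex.I * ((⟪x, ω⟫_ℝ : ℝ) : ℂ)) ∂μ
      = ((∫ ω, Real.cos ⟪x, ω⟫_ℝ ∂μ : ℝ) : ℂ) := by
  have hc : Integrable (fun ω : E => Real.cos ⟪x, ω⟫_ℝ) μ :=
    Integrable.of_bound (by fun_prop) 1 (.of_forall fun ω => Real.abs_cos_le_one _)
  have hs : Integrable (fun ω : E => Real.sin ⟪x, ω⟫_ℝ) μ :=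
    Integrable.of_bound (by fun_prop) 1 (.of_forall fun ω => Real.abs_sin_le_one _)
  have h0 : ∫ ω, Real.sin ⟪x, ω⟫_ℝ ∂μ = 0 := by
    have h := hμ.integral_comp (LinearIsometryEquiv.neg ℝ) fun ω => Real.sin ⟪x, ω⟫_ℝ
    simp only [LinearIsometryEquiv.coe_neg, inner_neg_right, Real.sin_neg, integral_neg] at h
    linarith
  have he : ∀ ω : E, Complex.exp (Complex.I * ((⟪x, ω⟫_ℝ : ℝ) : ℂ))
      = ((Real.cos ⟪x, ω⟫_ℝ : ℝ) : ℂ) + ((Real.sin ⟪x, ω⟫_ℝ : ℝ) : ℂ) * Complex.I := by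
    intro ω
    rw [mul_comm, Complex.exp_mul_I, Complex.ofReal_cos, Complex.ofReal_sin]
  simp_rw [he]
  rw [integral_add hc.ofReal (hs.ofReal.mul_const _), integral_mul_const,
    integral_complex_ofReal, integral_complex_ofReal, h0]
  simp

theorem IsSphericalMeasure.hasDerivAt_integral_cos [IsFiniteMeasure μ] (hμ : IsSphericalMeasure μ)
    (a b : E) (t : ℝ) :
    HasDerivAt (fun t : ℝ => ∫ ω, Real.cos ⟪a + t • b, ω⟫_ℝ ∂μ)
      (-∫ ω, ⟪b, ω⟫_ℝ * Real.sin ⟪a + t • b, ω⟫_ℝ ∂μ) t := by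
  rw [← integral_neg]
  refine (hasDerivAt_integral_of_dominated_loc_of_deriv_le
    (F := fun t ω => Real.cos ⟪a + t • b, ω⟫_ℝ)
    (F' := fun t ω => -(⟪b, ω⟫_ℝ * Real.sin ⟪a + t • b, ω⟫_ℝ)) (bound := fun _ => ‖b‖)
    Filter.univ_mem (.of_forall fun s => by fun_prop) ?_ (by fun_prop) ?_
    (integrable_const _) ?_).2
  · exact Integrable.of_bound (by fun_prop) 1 (.of_forall fun ω => Real.abs_cos_le_one _)
  · filter_upwards [hμ.norm_eq] with ω hω s _
    rw [norm_neg, norm_mul]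
    have h1 := norm_inner_le_norm (𝕜 := ℝ) b ω
    rw [hω, mul_one] at h1
    exact (mul_le_mul h1 (Real.abs_sin_le_one _) (abs_nonneg _) (norm_nonneg _)).trans
      (mul_one _).le
  · filter_upwards with ω s _
    have h : HasDerivAt (fun t : ℝ => ⟪a + t • b, ω⟫_ℝ) ⟪b, ω⟫_ℝ s := by
      simp only [inner_add_left, real_inner_smul_left]
      simpa using ((hasDerivAt_id s).mul_const ⟪b, ω⟫_ℝ).const_add ⟪a, ω⟫_ℝ
    exact h.cos.congr_deriv (by ring)

theorem IsSphericalMeasure.hasDerivAt_integral_inner_mul_sin [IsFiniteMeasure μ]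
    (hμ : IsSphericalMeasure μ) (a b : E) (t : ℝ) :
    HasDerivAt (fun t : ℝ => ∫ ω, ⟪b, ω⟫_ℝ * Real.sin ⟪a + t • b, ω⟫_ℝ ∂μ)
      (∫ ω, ⟪b, ω⟫_ℝ ^ 2 * Real.cos ⟪a + t • b, ω⟫_ℝ ∂μ) t := by
  have hb : ∀ᵐ ω ∂μ, ‖⟪b, ω⟫_ℝ‖ ≤ ‖b‖ := by
    filter_upwards [hμ.norm_eq] with ω hω
    simpa [hω] using norm_inner_le_norm (𝕜 := ℝ) b ω
  refine (hasDerivAt_integral_of_dominated_loc_of_deriv_le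
    (F := fun t ω => ⟪b, ω⟫_ℝ * Real.sin ⟪a + t • b, ω⟫_ℝ)
    (F' := fun t ω => ⟪b, ω⟫_ℝ ^ 2 * Real.cos ⟪a + t • b, ω⟫_ℝ) (bound := fun _ => ‖b‖ ^ 2)
    Filter.univ_mem (.of_forall fun s => by fun_prop) ?_ (by fun_prop) ?_
    (integrable_const _) ?_).2
  · refine Integrable.of_bound (by fun_prop) ‖b‖ ?_
    filter_upwards [hb] with ω hω
    rw [norm_mul]
    exact (mul_le_mul hω (Real.abs_sin_le_one _) (abs_nonneg _) (norm_nonneg _)).trans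
      (mul_one _).le
  · filter_upwards [hb] with ω hω s _
    rw [norm_mul, norm_pow]
    exact (mul_le_mul (pow_le_pow_left₀ (norm_nonneg _) hω 2) (Real.abs_cos_le_one _)
      (abs_nonneg _) (by positivity)).trans (mul_one _).le
  · filter_upwards with ω s _
    have h : HasDerivAt (fun t : ℝ => ⟪a + t • b, ω⟫_ℝ) ⟪b, ω⟫_ℝ s := by
      simp only [inner_add_left, real_inner_smul_left]
      simpa using ((hasDerivAt_id s).mul_const ⟪b, ω⟫_ℝ).const_add ⟪a, ω⟫_ℝ
    exact (h.sin.const_mul ⟪b, ω⟫_ℝ).congr_deriv (by ring)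

/-- The second derivative of the radial function `x ↦ ∫ cos ⟪x, ω⟫ dμ` in a tangential direction
is its radial derivative divided by the radius. -/
theorem IsSphericalMeasure.integral_sq_mul_cos_of_orthogonal [IsFiniteMeasure μ]
    (hμ : IsSphericalMeasure μ) {e f : E} (he : ‖e‖ = 1) (hf : ‖f‖ = 1) (hef : ⟪e, f⟫_ℝ = 0)
    {r : ℝ} (hr : 0 < r) :
    ∫ ω, ⟪f, ω⟫_ℝ ^ 2 * Real.cos ⟪r • e, ω⟫_ℝ ∂μ
      = (∫ ω, ⟪e, ω⟫_ℝ * Real.sin ⟪r • e, ω⟫_ℝ ∂μ) / r := by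
  set S : ℝ → ℝ := fun r => ∫ ω, ⟪e, ω⟫_ℝ * Real.sin ⟪r • e, ω⟫_ℝ ∂μ with hS
  -- g t is the norm of r e + t f; the plan is to differentiate the radial function twice along this
  -- line, at t = 0.
  set g : ℝ → ℝ := fun t => √(r ^ 2 + t ^ 2) with hg
  have hpos : ∀ t, 0 < r ^ 2 + t ^ 2 := fun t => by positivity
  have hgd : ∀ t, HasDerivAt g (t / g t) t := by
    intro t
    have h := (((hasDerivAt_id t).pow 2).const_add (r ^ 2)).sqrt (hpos t).ne'
    refine h.congr_deriv ?_
    simp only [id, hg, Pi.pow_apply]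
    have := Real.sqrt_pos.2 (hpos t)
    field_simp
    ring
  have hφ : ∀ s, HasDerivAt (fun r : ℝ => ∫ ω, Real.cos ⟪r • e, ω⟫_ℝ ∂μ) (-S s) s := by
    intro s
    simpa [hS] using hμ.hasDerivAt_integral_cos 0 e s
  have hSd : ∀ s, ContinuousAt S s := by
    intro s
    have := (hμ.hasDerivAt_integral_inner_mul_sin 0 e s).continuousAt
    simpa [hS] using this
  have hrad : ∀ t : ℝ, ∫ ω, Real.cos ⟪r • e + t • f, ω⟫_ℝ ∂μ
      = ∫ ω, Real.cos ⟪g t • e, ω⟫_ℝ ∂μ := by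
    intro t
    apply hμ.integral_cos_inner_congr
    have h0 : ⟪r • e, t • f⟫_ℝ = 0 := by simp [real_inner_smul_left, real_inner_smul_right, hef]
    have h1 := norm_add_sq_real (r • e) (t • f)
    rw [h0, norm_smul, norm_smul, he, hf] at h1
    simp only [Real.norm_eq_abs, mul_one, mul_zero, add_zero, sq_abs] at h1
    rw [norm_smul, he, mul_one, Real.norm_eq_abs, abs_of_nonneg (Real.sqrt_nonneg _), ← h1, Real.sqrt_sq (norm_nonneg _)]
  have hfirst : ∀ t : ℝ, ∫ ω, ⟪f, ω⟫_ℝ * Real.sin ⟪r • e + t • f, ω⟫_ℝ ∂μ = t * (S (g t) / g t) := by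
    intro t
    have h1 := hμ.hasDerivAt_integral_cos (r • e) f t
    have h2 := (hφ (g t)).comp t (hgd t)
    have h3 : (fun t : ℝ => ∫ ω, Real.cos ⟪r • e + t • f, ω⟫_ℝ ∂μ)
        = (fun r : ℝ => ∫ ω, Real.cos ⟪r • e, ω⟫_ℝ ∂μ) ∘ g := funext hrad
    rw [h3] at h1
    have := h1.unique h2
    linear_combination -this
  have hd := hμ.hasDerivAt_integral_inner_mul_sin (r • e) f 0
  simp only [hfirst, zero_smul, add_zero] at hd
  have hcont : ContinuousAt (fun t => S (g t) / g t) 0 :=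
    (ContinuousAt.comp (hSd _) (hgd 0).continuousAt).div (hgd 0).continuousAt
      (Real.sqrt_pos.2 (hpos 0)).ne'
  -- For h continuous at 0, t h(t) has derivative h(0) there; differentiability of S is not needed.
  have hd2 : HasDerivAt (fun t => t * (S (g t) / g t)) (S (g 0) / g 0) 0 := by
    rw [hasDerivAt_iff_tendsto_slope]
    refine (hcont.tendsto.mono_left nhdsWithin_le_nhds).congr' ?_
    filter_upwards [self_mem_nhdsWithin] with t ht
    have ht' : t ≠ 0 := ht
    simp only [slope_def_field]
    field_simp
    ring
  have hg0 : g 0 = r := by simp [hg, Real.sqrt_sq hr.le]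
  rw [hg0] at hd2
  exact hd.unique hd2

/-- The squared coordinates sum to 1 on the sphere, so the transform φ satisfies Δφ = -φ; the N
tangential directions each contribute S/r. -/
theorem IsSphericalMeasure.bessel_equation [IsFiniteMeasure μ] {N : ℕ}
    (hμ : IsSphericalMeasure μ) (b : OrthonormalBasis (Fin (N + 1)) ℝ E) {r : ℝ} (hr : 0 < r) :
    ∫ ω, ⟪b 0, ω⟫_ℝ ^ 2 * Real.cos ⟪r • b 0, ω⟫_ℝ ∂μ
      = ∫ ω, Real.cos ⟪r • b 0, ω⟫_ℝ ∂μ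
        - N * ((∫ ω, ⟪b 0, ω⟫_ℝ * Real.sin ⟪r • b 0, ω⟫_ℝ ∂μ) / r) := by
  have hsum : ∑ i, ∫ ω, ⟪b i, ω⟫_ℝ ^ 2 * Real.cos ⟪r • b 0, ω⟫_ℝ ∂μ
      = ∫ ω, Real.cos ⟪r • b 0, ω⟫_ℝ ∂μ := by
    rw [← integral_finsetSum]
    · refine integral_congr_ae ?_
      filter_upwards [hμ.norm_eq] with ω hω
      rw [← Finset.sum_mul, b.sum_sq_inner_right, hω]
      simp
    · intro i _
      refine Integrable.of_bound (by fun_prop) 1 ?_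
      filter_upwards [hμ.norm_eq] with ω hω
      have h1 := norm_inner_le_norm (𝕜 := ℝ) (b i) ω
      rw [hω, b.norm_eq_one, mul_one] at h1
      rw [norm_mul, norm_pow]
      exact mul_le_one₀ (pow_le_one₀ (norm_nonneg _) h1) (norm_nonneg _) (Real.abs_cos_le_one _)
  rw [Fin.sum_univ_succ] at hsum
  have ht : ∀ i : Fin N, ∫ ω, ⟪b i.succ, ω⟫_ℝ ^ 2 * Real.cos ⟪r • b 0, ω⟫_ℝ ∂μ
      = (∫ ω, ⟪b 0, ω⟫_ℝ * Real.sin ⟪r • b 0, ω⟫_ℝ ∂μ) / r := fun i =>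
    hμ.integral_sq_mul_cos_of_orthogonal (b.norm_eq_one _) (b.norm_eq_one _)
      (b.inner_eq_zero (Fin.succ_ne_zero i).symm) hr
  simp only [ht, Finset.sum_const, Finset.card_univ, Fintype.card_fin, nsmul_eq_mul] at hsum
  linarith

end SphericalMeasure

/-! ### Decay of Fourier transforms of spherical measures. -/

/-- Solutions of Bessel's equation `φ'' + (2a/r) φ' + φ = 0` are `O(r^{-a})` at infinity. -/
theorem exists_bound_of_bessel_equation {a : ℝ} {φ S : ℝ → ℝ}
    (hφ : ∀ r, 0 < r → HasDerivAt φ (-S r) r)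
    (hS : ∀ r, 0 < r → HasDerivAt S (φ r - 2 * a * (S r / r)) r) :
    ∃ K, ∀ r, 1 ≤ r → |φ r| ≤ K * r ^ (-a) := by
  -- ψ = r^a φ removes the first-order term: ψ'' = (c/r² - 1) ψ, with χ = ψ'.
  set c := a * (a - 1) with hc
  set ψ : ℝ → ℝ := fun r => r ^ a * φ r with hψ
  set χ : ℝ → ℝ := fun r => r ^ a * (a * (φ r / r) - S r) with hχ
  have hψd : ∀ r, 0 < r → HasDerivAt ψ (χ r) r := by
    intro r hr
    refine ((Real.hasDerivAt_rpow_const (p := a) (Or.inl hr.ne')).mul (hφ r hr)).congr_deriv ?_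
    rw [Real.rpow_sub_one hr.ne', hχ]
    ring
  have hχd : ∀ r, 0 < r → HasDerivAt χ ((c / r ^ 2 - 1) * ψ r) r := by
    intro r hr
    refine ((Real.hasDerivAt_rpow_const (p := a) (Or.inl hr.ne')).mul
      ((((hφ r hr).div (hasDerivAt_id r) hr.ne').const_mul a).sub (hS r hr))).congr_deriv ?_
    rw [Real.rpow_sub_one hr.ne', hψ, hc]
    simp only [id, Pi.sub_apply, Pi.div_apply]
    field_simp
    ring
  -- The energy ψ² + χ² grows at relative rate at most |c|/r², which is integrable at infinity; the
  -- exponential, always at least 1, absorbs this growth.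
  set M : ℝ → ℝ := fun r => (ψ r ^ 2 + χ r ^ 2) * Real.exp (|c| / r) with hM
  have hMd : ∀ r, 0 < r → HasDerivAt M
      ((2 * ψ r * χ r * (c / r ^ 2) - |c| / r ^ 2 * (ψ r ^ 2 + χ r ^ 2)) * Real.exp (|c| / r)) r := by
    intro r hr
    have hexp : HasDerivAt (fun r => Real.exp (|c| / r)) (Real.exp (|c| / r) * (-|c| / r ^ 2)) r := by
      refine ((hasDerivAt_const r |c|).div (hasDerivAt_id r) hr.ne').exp.congr_deriv ?_
      simp
    refine ((((hψd r hr).pow 2).add ((hχd r hr).pow 2)).mul hexp).congr_deriv ?_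
    simp only [Pi.add_apply, Pi.pow_apply]
    push_cast
    ring
  have hanti : AntitoneOn M (Set.Ici 1) := by
    refine antitoneOn_of_deriv_nonpos (convex_Ici 1) ?_ ?_ ?_
    · exact fun r hr => (hMd r (zero_lt_one.trans_le hr)).continuousAt.continuousWithinAt
    · rw [interior_Ici]
      exact fun r hr => (hMd r (zero_lt_one.trans hr)).differentiableAt.differentiableWithinAt
    · rw [interior_Ici]
      intro r hr
      have hr0 : (0 : ℝ) < r := zero_lt_one.trans hr
      rw [(hMd r hr0).deriv]
      refine mul_nonpos_of_nonpos_of_nonneg ?_ (Real.exp_pos _).le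
      have h1 : 2 * ψ r * χ r * c ≤ |c| * (ψ r ^ 2 + χ r ^ 2) := by
        have h2 : |2 * ψ r * χ r| ≤ ψ r ^ 2 + χ r ^ 2 := by
          rw [abs_le]
          constructor <;> nlinarith [sq_nonneg (ψ r + χ r), sq_nonneg (ψ r - χ r)]
        calc 2 * ψ r * χ r * c ≤ |2 * ψ r * χ r * c| := le_abs_self _
          _ = |c| * |2 * ψ r * χ r| := by rw [abs_mul, mul_comm]
          _ ≤ _ := by gcongr
      have h3 : 2 * ψ r * χ r * (c / r ^ 2) - |c| / r ^ 2 * (ψ r ^ 2 + χ r ^ 2)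
          = (2 * ψ r * χ r * c - |c| * (ψ r ^ 2 + χ r ^ 2)) / r ^ 2 := by ring
      rw [h3]
      exact div_nonpos_of_nonpos_of_nonneg (by linarith) (by positivity)
  refine ⟨√(M 1), fun r hr => ?_⟩
  have hr0 : (0 : ℝ) < r := zero_lt_one.trans_le hr
  have h1 : M r ≤ M 1 := hanti Set.self_mem_Ici hr hr
  have h2 : ψ r ^ 2 ≤ M r := by
    have : 1 ≤ Real.exp (|c| / r) := Real.one_le_exp (by positivity)
    calc ψ r ^ 2 ≤ ψ r ^ 2 + χ r ^ 2 := by nlinarith [sq_nonneg (χ r)]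
      _ ≤ M r := le_mul_of_one_le_right (by positivity) this
  have h3 : |ψ r| ≤ √(M 1) := Real.abs_le_sqrt (h2.trans h1)
  have h4 : φ r = ψ r * r ^ (-a) := by
    rw [hψ, Real.rpow_neg hr0.le]
    have := (Real.rpow_pos_of_pos hr0 a).ne'
    field_simp
  rw [h4, abs_mul, abs_of_pos (Real.rpow_pos_of_pos hr0 (-a))]
  gcongr

theorem IsSphericalMeasure.exists_norm_integral_exp_le {E : Type*} [NormedAddCommGroup E]
    [InnerProductSpace ℝ E] [MeasurableSpace E] [BorelSpace E] [FiniteDimensional ℝ E]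
    {μ : Measure E} [IsFiniteMeasure μ] {N : ℕ}
    (hμ : IsSphericalMeasure μ) (b : OrthonormalBasis (Fin (N + 1)) ℝ E) :
    ∃ C, ∀ x : E, ‖∫ ω, Complex.exp (Complex.I * ((⟪x, ω⟫_ℝ : ℝ) : ℂ)) ∂μ‖
      ≤ C * (1 + ‖x‖) ^ (-((N : ℝ) / 2)) := by
  obtain ⟨K, hK⟩ := exists_bound_of_bessel_equation (a := (N : ℝ) / 2)
    (φ := fun r => ∫ ω, Real.cos ⟪r • b 0, ω⟫_ℝ ∂μ)
    (S := fun r => ∫ ω, ⟪b 0, ω⟫_ℝ * Real.sin ⟪r • b 0, ω⟫_ℝ ∂μ)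
    (fun r _ => by simpa using hμ.hasDerivAt_integral_cos 0 (b 0) r)
    (fun r hr => by
      have h := hμ.hasDerivAt_integral_inner_mul_sin 0 (b 0) r
      simp only [zero_add] at h
      refine h.congr_deriv ?_
      rw [hμ.bessel_equation b hr]
      ring)
  have hK0 : 0 ≤ K := by
    have := (abs_nonneg _).trans (hK 1 le_rfl)
    simpa using this
  refine ⟨2 ^ ((N : ℝ) / 2) * (K + μ.real Set.univ), fun x => ?_⟩
  have hx : ∫ ω, Real.cos ⟪x, ω⟫_ℝ ∂μ = ∫ ω, Real.cos ⟪‖x‖ • b 0, ω⟫_ℝ ∂μ :=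
    hμ.integral_cos_inner_congr (by simp [norm_smul])
  rw [hμ.integral_exp_inner, Complex.norm_real, hx, Real.norm_eq_abs]
  have hx0 := norm_nonneg x
  -- Used with s = ‖x‖ when ‖x‖ ≥ 1 and with s = 1 otherwise, where the total mass is a sufficient
  -- bound.
  have htwo : ∀ s : ℝ, 0 < s → 1 + ‖x‖ ≤ 2 * s →
      s ^ (-((N : ℝ) / 2)) ≤ 2 ^ ((N : ℝ) / 2) * (1 + ‖x‖) ^ (-((N : ℝ) / 2)) := by
    intro s hs hle
    calc s ^ (-((N : ℝ) / 2)) = 2 ^ ((N : ℝ) / 2) * (2 * s) ^ (-((N : ℝ) / 2)) := by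
          rw [Real.mul_rpow zero_le_two hs.le, ← mul_assoc, ← Real.rpow_add zero_lt_two]
          simp
      _ ≤ _ := by
          gcongr 2 ^ ((N : ℝ) / 2) * ?_
          exact Real.rpow_le_rpow_of_nonpos (by positivity) hle (by simp; positivity)
  rcases le_total 1 ‖x‖ with h | h
  · refine (hK _ h).trans ?_
    have h1 := htwo ‖x‖ (by linarith) (by linarith)
    calc K * ‖x‖ ^ (-((N : ℝ) / 2))
        ≤ K * (2 ^ ((N : ℝ) / 2) * (1 + ‖x‖) ^ (-((N : ℝ) / 2))) := by gcongr
      _ ≤ (K + μ.real Set.univ) * (2 ^ ((N : ℝ) / 2) * (1 + ‖x‖) ^ (-((N : ℝ) / 2))) := by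
          gcongr
          simp
      _ = _ := by ring
  · have h1 := htwo 1 one_pos (by linarith)
    rw [Real.one_rpow] at h1
    have h2 : |∫ ω, Real.cos ⟪‖x‖ • b 0, ω⟫_ℝ ∂μ| ≤ μ.real Set.univ := by
      simpa using norm_integral_le_of_norm_le_const (μ := μ) (C := 1)
        (f := fun ω => Real.cos ⟪‖x‖ • b 0, ω⟫_ℝ) (.of_forall fun ω => Real.abs_cos_le_one _)
    calc _ ≤ (K + μ.real Set.univ) * 1 := by linarith
      _ ≤ (K + μ.real Set.univ) * (2 ^ ((N : ℝ) / 2) * (1 + ‖x‖) ^ (-((N : ℝ) / 2))) := by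
          gcongr
      _ = _ := by ring

theorem IsSphericalMeasure.smul {E : Type*} [NormedAddCommGroup E] [InnerProductSpace ℝ E]
    [MeasurableSpace E] {μ : Measure E} (hμ : IsSphericalMeasure μ) (c : ENNReal) :
    IsSphericalMeasure (c • μ) where
  map_eq L := by rw [Measure.map_smul, hμ.map_eq L]
  norm_eq := Measure.ae_smul_measure hμ.norm_eq c

/-! ### Averaging over frequencies of fixed norm. -/

theorem inv_sqrt_pow_eq_rpow {t : ℝ} (ht : 0 ≤ t) (M : ℕ) :
    (√(t ^ M))⁻¹ = t ^ (-((M : ℝ) / 2)) := by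
  rw [Real.rpow_neg ht, Real.sqrt_eq_rpow, ← Real.rpow_natCast_mul ht]
  ring_nf

/-- Averaging a plane wave of frequency `y` over suitable rotations of `y` gains decay in `y`. -/
theorem exists_averaging_measure (N : ℕ) :
    ∃ C : ℝ, 0 ≤ C ∧ ∀ y : EuclideanSpace ℝ (Fin N), ∃ μ : Measure (EuclideanSpace ℝ (Fin N)),
      IsProbabilityMeasure μ ∧ (∀ᵐ v ∂μ, ‖v‖ = ‖y‖) ∧
      ∀ u, ‖u‖ ≤ 1 → (N ≤ 1 ∨ u ≠ 0) →
        ‖∫ v, Complex.exp (Complex.I * ((⟪v, u⟫_ℝ : ℝ) : ℂ)) ∂μ‖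
          ≤ C * (√(‖u‖ ^ (N - 1)))⁻¹ * (1 + ‖y‖) ^ ((1 - (N : ℝ)) / 2) := by
  rcases Nat.lt_or_ge 1 N with hN | hN
  · obtain ⟨M, rfl⟩ : ∃ M, N = M + 1 := ⟨N - 1, by omega⟩
    have : Nonempty (Fin M) := ⟨⟨0, by omega⟩⟩
    set E := EuclideanSpace ℝ (Fin (M + 1))
    set σ : Measure E := (volume : Measure E).toSphere.map Subtype.val with hσ
    have hm : Measurable (Subtype.val : sphere (0 : E) 1 → E) := measurable_subtype_coe
    have hσ0 : NeZero σ := ⟨by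
      rw [hσ, Ne, Measure.map_eq_zero_iff hm.aemeasurable]
      exact Measure.toSphere_ne_zero _⟩
    have hσf : IsFiniteMeasure σ := Measure.isFiniteMeasure_map _ _
    set ν : Measure E := (σ Set.univ)⁻¹ • σ with hν
    have hνp : IsProbabilityMeasure ν := inferInstance
    have hνs : IsSphericalMeasure ν := isSphericalMeasure_map_toSphere.smul _
    obtain ⟨C, hC⟩ := hνs.exists_norm_integral_exp_le (EuclideanSpace.basisFun (Fin (M + 1)) ℝ)
    have hC0 : 0 ≤ C := by
      have := (norm_nonneg _).trans (hC 0)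
      simpa using this
    refine ⟨C, hC0, fun y => ⟨ν.map fun v => ‖y‖ • v, ?_, ?_, fun u hu hu0 => ?_⟩⟩
    · exact Measure.isProbabilityMeasure_map (by fun_prop)
    · rw [ae_map_iff (by fun_prop) (measurableSet_eq_fun (by fun_prop) (by fun_prop))]
      filter_upwards [hνs.norm_eq] with v hv
      have hv' : ‖v‖ = 1 := hv
      simp [norm_smul, hv']
    · have hu0 : 0 < ‖u‖ := norm_pos_iff.2 (hu0.resolve_left (by omega))
      have hy0 := norm_nonneg y
      rw [integral_map (by fun_prop) (by fun_prop)]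
      have h1 : ∀ v : E, ⟪‖y‖ • v, u⟫_ℝ = ⟪‖y‖ • u, v⟫_ℝ := fun v => by
        rw [real_inner_smul_left, real_inner_smul_left, real_inner_comm]
      simp only [h1]
      refine (hC _).trans ?_
      rw [norm_smul, norm_norm, mul_assoc, Nat.add_sub_cancel, inv_sqrt_pow_eq_rpow hu0.le]
      have h2 : (1 - ((M + 1 : ℕ) : ℝ)) / 2 = -((M : ℝ) / 2) := by push_cast; ring
      rw [h2, ← Real.mul_rpow hu0.le (by positivity)]
      gcongr C * ?_
      -- Here ‖u‖ (1 + ‖y‖) ≤ 1 + ‖y‖ ‖u‖, because ‖u‖ ≤ 1.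
      exact Real.rpow_le_rpow_of_nonpos (by positivity) (by nlinarith) (by simp; positivity)
  -- No decay is claimed for N ≤ 1: the exponent is 0 if N = 1, and y = 0 if N = 0.
  · refine ⟨1, zero_le_one, fun y => ⟨Measure.dirac y, inferInstance, by simp, fun u _ _ => ?_⟩⟩
    have h0 : N - 1 = 0 := by omega
    rw [integral_dirac, mul_comm Complex.I, Complex.norm_exp_ofReal_mul_I, h0]
    have h1 : (1 + ‖y‖) ^ ((1 - (N : ℝ)) / 2) = 1 := by
      interval_cases N
      · simp [Subsingleton.elim y 0]
      · simp
    simp [h1]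

/-! ### Integrability of the singular weight on the sphere. -/

theorem integrableOn_inv_norm_pow (N : ℕ) :
    IntegrableOn (fun y : EuclideanSpace ℝ (Fin N) => (‖y‖ ^ (N - 1))⁻¹) (ball 0 1) := by
  rcases Nat.eq_zero_or_pos N with rfl | hN
  · simp
  · have : Nonempty (Fin N) := ⟨⟨0, hN⟩⟩
    rw [integrableOn_fun_norm_addHaar volume (f := fun t : ℝ => (t ^ (N - 1))⁻¹)]
    have h : Set.EqOn (fun _ : ℝ => (1 : ℝ)) (fun y : ℝ =>
        y ^ (Module.finrank ℝ (EuclideanSpace ℝ (Fin N)) - 1) • (y ^ (N - 1))⁻¹)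
        (Set.Ioo 0 1) := by
      intro y hy
      have : y ^ (N - 1) ≠ 0 := pow_ne_zero _ hy.1.ne'
      simp [this]
    exact IntegrableOn.congr_fun (by simp) h measurableSet_Ioo

section ProductSphere

variable {U V : Type*} [NormedAddCommGroup U] [InnerProductSpace ℝ U] [MeasurableSpace U]
  [BorelSpace U] [FiniteDimensional ℝ U] [NormedAddCommGroup V] [InnerProductSpace ℝ V]
  [MeasurableSpace V] [BorelSpace V] [FiniteDimensional ℝ V]

/-- The product is integrable over a product of balls, hence by polar coordinates and Fubini over
almost every small sphere; homogeneity carries this to the unit sphere. -/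
theorem integrable_toSphere_inv_norm_pow_mul {p q : ℕ}
    (hp : IntegrableOn (fun y : U => (‖y‖ ^ p)⁻¹) (ball 0 1))
    (hq : IntegrableOn (fun z : V => (‖z‖ ^ q)⁻¹) (ball 0 1)) :
    Integrable (fun ω : sphere (0 : WithLp 2 (U × V)) 1 =>
        (‖ω.1.fst‖ ^ p)⁻¹ * (‖ω.1.snd‖ ^ q)⁻¹)
      (volume : Measure (WithLp 2 (U × V))).toSphere := by
  set W := WithLp 2 (U × V)
  set g₁ : U → ℝ := (ball 0 1).indicator fun y => (‖y‖ ^ p)⁻¹ with hg₁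
  set g₂ : V → ℝ := (ball 0 1).indicator fun z => (‖z‖ ^ q)⁻¹ with hg₂
  have h₁ : Integrable g₁ := (integrable_indicator_iff measurableSet_ball).2 hp
  have h₂ : Integrable g₂ := (integrable_indicator_iff measurableSet_ball).2 hq
  have hG : Integrable (fun x : W => g₁ x.fst * g₂ x.snd) := by
    have := (WithLp.volume_preserving_ofLp U V).integrable_comp_of_integrable (h₁.mul_prod h₂)
    exact this
  have hsph := (volume : Measure W).measurePreserving_homeomorphUnitSphereProd
  have hprod : Integrable (fun x : sphere (0 : W) 1 × Set.Ioi (0 : ℝ) =>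
      g₁ ((x.2 : ℝ) • (x.1 : W)).fst * g₂ ((x.2 : ℝ) • (x.1 : W)).snd)
      ((volume : Measure W).toSphere.prod (Measure.volumeIoiPow (Module.finrank ℝ W - 1))) := by
    rw [← hsph.integrable_comp_emb (Homeomorph.measurableEmbedding _)]
    have hc := (integrableOn_iff_comap_subtypeVal (μ := volume)
      (measurableSet_singleton (0 : W)).compl).1 hG.integrableOn
    refine hc.congr (.of_forall fun x => ?_)
    have hx : ((homeomorphUnitSphereProd W x).2 : ℝ) • ((homeomorphUnitSphereProd W x).1 : W)
        = x := by
      rw [← homeomorphUnitSphereProd_symm_apply_coe, Homeomorph.symm_apply_apply]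
    simp only [Function.comp, hx]
  -- r < 1 puts both blocks of r ω in the open unit balls, where the indicators equal 1.
  obtain ⟨r, hr1, hr⟩ : ∃ r : Set.Ioi (0 : ℝ), (r : ℝ) < 1 ∧
      Integrable (fun ω : sphere (0 : W) 1 =>
        g₁ ((r : ℝ) • (ω : W)).fst * g₂ ((r : ℝ) • (ω : W)).snd)
        (volume : Measure W).toSphere := by
    by_contra! hcon
    have hae := hprod.prod_left_ae
    have h0 : Measure.volumeIoiPow (Module.finrank ℝ W - 1)
        (Set.Iio (⟨1, Set.mem_Ioi.2 one_pos⟩ : Set.Ioi (0 : ℝ))) = 0 :=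
      measure_mono_null (fun r hr hr' => hcon r hr hr') hae
    rw [Measure.volumeIoiPow_apply_Iio, ENNReal.ofReal_eq_zero] at h0
    have : (0 : ℝ) < 1 ^ (Module.finrank ℝ W - 1 + 1) / ((Module.finrank ℝ W - 1 : ℕ) + 1) := by
      positivity
    linarith
  have hr0 : (0 : ℝ) < r := r.2
  refine (hr.const_mul ((r : ℝ) ^ p * (r : ℝ) ^ q)).congr (.of_forall fun ω => ?_)
  have hω : ‖ω.1‖ ^ 2 = 1 := by simp
  rw [WithLp.prod_norm_sq_eq_of_L2] at hω
  have hy : ‖ω.1.fst‖ ≤ 1 := by nlinarith [norm_nonneg ω.1.fst, sq_nonneg ‖ω.1.snd‖]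
  have hz : ‖ω.1.snd‖ ≤ 1 := by nlinarith [norm_nonneg ω.1.snd, sq_nonneg ‖ω.1.fst‖]
  have hy' : (r : ℝ) • ω.1.fst ∈ ball (0 : U) 1 := by
    rw [mem_ball_zero_iff, norm_smul, Real.norm_of_nonneg hr0.le]
    nlinarith [norm_nonneg ω.1.fst]
  have hz' : (r : ℝ) • ω.1.snd ∈ ball (0 : V) 1 := by
    rw [mem_ball_zero_iff, norm_smul, Real.norm_of_nonneg hr0.le]
    nlinarith [norm_nonneg ω.1.snd]
  have hyω : ((r : ℝ) • (ω : W)).fst = (r : ℝ) • ω.1.fst := rfl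
  have hzω : ((r : ℝ) • (ω : W)).snd = (r : ℝ) • ω.1.snd := rfl
  beta_reduce
  rw [hyω, hzω, hg₁, hg₂, Set.indicator_of_mem hy', Set.indicator_of_mem hz', norm_smul, norm_smul,
    Real.norm_of_nonneg hr0.le, mul_pow, mul_pow, mul_inv, mul_inv]
  have hp0 : (r : ℝ) ^ p ≠ 0 := by positivity
  have hq0 : (r : ℝ) ^ q ≠ 0 := by positivity
  field_simp

/-- By `hsmul`, the cone over the exceptional set on the sphere stays inside the exceptional set in
E. -/
theorem ae_toSphere_of_ae_volume {E : Type*} [NormedAddCommGroup E] [NormedSpace ℝ E]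
    [MeasurableSpace E] [BorelSpace E] {μ : Measure E} {P : E → Prop}
    (hP : MeasurableSet {x | P x}) (hsmul : ∀ (r : ℝ) (x : E), 0 < r → P (r • x) → P x)
    (h : ∀ᵐ x ∂μ, P x) : ∀ᵐ ω : sphere (0 : E) 1 ∂μ.toSphere, P ω := by
  have hm : MeasurableSet {ω : sphere (0 : E) 1 | ¬ P ω} := (measurable_subtype_coe hP).compl
  rw [ae_iff, Measure.toSphere_apply' _ hm, mul_eq_zero]
  right
  refine measure_mono_null ?_ h
  rintro _ ⟨r, hr, _, ⟨ω, hω, rfl⟩, rfl⟩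
  exact fun h' => hω (hsmul r _ hr.1 h')

theorem ae_toSphere_fst_ne_zero [Nontrivial U] :
    ∀ᵐ ω ∂(volume : Measure (WithLp 2 (U × V))).toSphere, ω.1.fst ≠ 0 := by
  have hm : MeasurableSet {x : WithLp 2 (U × V) | x.fst ≠ 0} :=
    (isOpen_ne_fun (by fun_prop) continuous_const).measurableSet
  refine ae_toSphere_of_ae_volume (P := fun x : WithLp 2 (U × V) => x.fst ≠ 0) hm
    (fun r x _ h h' => h (by simp [h'])) ?_
  refine (WithLp.volume_preserving_ofLp U V).quasiMeasurePreserving.ae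
    (p := fun x : U × V => x.1 ≠ 0) ?_
  exact Measure.quasiMeasurePreserving_fst.ae (Measure.ae_ne volume (0 : U))

theorem ae_toSphere_snd_ne_zero [Nontrivial V] :
    ∀ᵐ ω ∂(volume : Measure (WithLp 2 (U × V))).toSphere, ω.1.snd ≠ 0 := by
  have hm : MeasurableSet {x : WithLp 2 (U × V) | x.snd ≠ 0} :=
    (isOpen_ne_fun (by fun_prop) continuous_const).measurableSet
  refine ae_toSphere_of_ae_volume (P := fun x : WithLp 2 (U × V) => x.snd ≠ 0) hm
    (fun r x _ h h' => h (by simp [h'])) ?_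
  refine (WithLp.volume_preserving_ofLp U V).quasiMeasurePreserving.ae
    (p := fun x : U × V => x.2 ≠ 0) ?_
  exact Measure.quasiMeasurePreserving_snd.ae (Measure.ae_ne volume (0 : V))

end ProductSphere

/-! ### Extensions of symmetric functions. -/

theorem integral_norm_mul_le_norm_mul_norm_toLp {α : Type*} [MeasurableSpace α] {μ : Measure α}
    (F : Lp ℂ 2 μ) {w : α → ℝ} (hw : MemLp w 2 μ) :
    ∫ x, ‖F x‖ * w x ∂μ ≤ ‖F‖ * ‖hw.toLp w‖ := by
  have hF : MemLp (fun x => ‖F x‖) 2 μ := (Lp.memLp F).norm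
  have h1 : ‖hF.toLp _‖ = ‖F‖ := by
    rw [Lp.norm_toLp, eLpNorm_norm, Lp.norm_def]
  have h2 : ⟪hF.toLp _, hw.toLp w⟫_ℝ = ∫ x, ‖F x‖ * w x ∂μ := by
    rw [L2.inner_def]
    refine integral_congr_ae ?_
    filter_upwards [hF.coeFn_toLp, hw.coeFn_toLp] with x h3 h4
    rw [h3, h4]
    simp [mul_comm]
  rw [← h1, ← h2]
  exact real_inner_le_norm _ _

theorem measurePreserving_blockRotate {d k : ℕ}
    (A : EuclideanSpace ℝ (Fin (d - k)) ≃ₗᵢ[ℝ] EuclideanSpace ℝ (Fin (d - k)))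
    (B : EuclideanSpace ℝ (Fin k) ≃ₗᵢ[ℝ] EuclideanSpace ℝ (Fin k)) :
    MeasurePreserving (blockRotate A B) (surfaceMeasure d k) (surfaceMeasure d k) :=
  measurePreserving_unitSphereMap (LinearIsometryEquiv.withLpProdCongr 2 A B)

instance isFiniteMeasure_surfaceMeasure (d k : ℕ) : IsFiniteMeasure (surfaceMeasure d k) :=
  inferInstanceAs (IsFiniteMeasure (volume : Measure (BlockSpace d k)).toSphere)

theorem integral_eq_integral_comp_of_measurePreserving {α β G : Type*} [MeasurableSpace α]
    [MeasurableSpace β] [NormedAddCommGroup G] [NormedSpace ℝ G] {μ : Measure α} {ν : Measure β}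
    {T : α → β} (hT : MeasurePreserving T μ ν) {f : β → G} (hf : AEStronglyMeasurable f ν) :
    ∫ x, f x ∂ν = ∫ x, f (T x) ∂μ := by
  rw [← hT.map_eq] at hf ⊢
  exact integral_map hT.aemeasurable hf

/-- The extension of a symmetric function depends only on the two block norms. -/
theorem IsBlockSymmetric.sphereExtension_congr {d k : ℕ} {F : Lp ℂ 2 (surfaceMeasure d k)}
    (hF : IsBlockSymmetric F) {v y : EuclideanSpace ℝ (Fin (d - k))}
    {w z : EuclideanSpace ℝ (Fin k)} (hv : ‖v‖ = ‖y‖) (hw : ‖w‖ = ‖z‖) :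
    sphereExtension F (WithLp.toLp 2 (v, w)) = sphereExtension F (WithLp.toLp 2 (y, z)) := by
  obtain ⟨A, rfl⟩ := exists_linearIsometryEquiv_apply_eq hv
  obtain ⟨B, rfl⟩ := exists_linearIsometryEquiv_apply_eq hw
  have hT := measurePreserving_blockRotate A B
  have hm : AEStronglyMeasurable (fun ω : BlockSphere d k => F ω * Complex.exp (Complex.I *
      ((⟪WithLp.toLp 2 (A v, B w), (ω : BlockSpace d k)⟫_ℝ : ℝ) : ℂ))) (surfaceMeasure d k) :=
    (Lp.aestronglyMeasurable F).mul (Continuous.aestronglyMeasurable (by fun_prop))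
  have h : sphereExtension F (WithLp.toLp 2 (A v, B w)) =
      ∫ ω, F (blockRotate A B ω) * Complex.exp (Complex.I *
        ((⟪WithLp.toLp 2 (A v, B w), (blockRotate A B ω : BlockSpace d k)⟫_ℝ : ℝ) : ℂ))
        ∂(surfaceMeasure d k) :=
    integral_eq_integral_comp_of_measurePreserving hT hm
  rw [h, sphereExtension]
  refine integral_congr_ae ?_
  filter_upwards [hF A B] with ω hω
  rw [hω]
  simp [blockRotate, WithLp.prod_inner_apply]

/-- Averaging the plane wave over the frequencies with the given block norms. -/
theorem IsBlockSymmetric.sphereExtension_eq {d k : ℕ} {F : Lp ℂ 2 (surfaceMeasure d k)}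
    (hF : IsBlockSymmetric F) {y : EuclideanSpace ℝ (Fin (d - k))} {z : EuclideanSpace ℝ (Fin k)}
    {μ : Measure (EuclideanSpace ℝ (Fin (d - k)))} {ν : Measure (EuclideanSpace ℝ (Fin k))}
    [IsProbabilityMeasure μ] [IsProbabilityMeasure ν]
    (hμ : ∀ᵐ v ∂μ, ‖v‖ = ‖y‖) (hν : ∀ᵐ w ∂ν, ‖w‖ = ‖z‖) :
    sphereExtension F (WithLp.toLp 2 (y, z)) =
      ∫ ω, F ω * ((∫ v, Complex.exp (Complex.I * ((⟪v, ω.1.fst⟫_ℝ : ℝ) : ℂ)) ∂μ) *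
        ∫ w, Complex.exp (Complex.I * ((⟪w, ω.1.snd⟫_ℝ : ℝ) : ℂ)) ∂ν) ∂(surfaceMeasure d k) := by
  have hμ' : ∀ᵐ p ∂μ.prod ν, ‖p.1‖ = ‖y‖ := Measure.quasiMeasurePreserving_fst.ae hμ
  have hν' : ∀ᵐ p ∂μ.prod ν, ‖p.2‖ = ‖z‖ := Measure.quasiMeasurePreserving_snd.ae hν
  have h1 : sphereExtension F (WithLp.toLp 2 (y, z))
      = ∫ p, sphereExtension F (WithLp.toLp 2 p) ∂(μ.prod ν) := by
    have h2 : ∀ᵐ p ∂μ.prod ν, sphereExtension F (WithLp.toLp 2 p)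
        = sphereExtension F (WithLp.toLp 2 (y, z)) := by
      filter_upwards [hμ', hν'] with p hp1 hp2
      exact hF.sphereExtension_congr hp1 hp2
    rw [integral_congr_ae h2]
    simp
  rw [h1]
  simp only [sphereExtension]
  rw [integral_integral_swap]
  · refine integral_congr_ae (.of_forall fun ω => ?_)
    simp only
    rw [integral_const_mul, ← integral_prod_mul]
    congr 1
    refine integral_congr_ae (.of_forall fun p => ?_)
    simp only [WithLp.prod_inner_apply]
    rw [← Complex.exp_add]
    push_cast
    ring_nf
    rfl
  · have hFi : Integrable F (surfaceMeasure d k) := (Lp.memLp F).integrable (by norm_num)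
    refine Integrable.mul_bdd (c := 1) (hFi.comp_snd (μ.prod ν)) ?_ (.of_forall fun p => ?_)
    · exact Continuous.aestronglyMeasurable (by fun_prop)
    · rw [mul_comm Complex.I, Complex.norm_exp_ofReal_mul_I]

theorem memLp_inv_sqrt_norm_pow_mul (d k : ℕ) :
    MemLp (fun ω : BlockSphere d k =>
      (√(‖ω.1.fst‖ ^ (d - k - 1)))⁻¹ * (√(‖ω.1.snd‖ ^ (k - 1)))⁻¹) 2 (surfaceMeasure d k) := by
  have hm : Measurable (fun ω : BlockSphere d k =>
      (√(‖ω.1.fst‖ ^ (d - k - 1)))⁻¹ * (√(‖ω.1.snd‖ ^ (k - 1)))⁻¹) := by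
    have h1 : Measurable fun ω : BlockSphere d k => ω.1.fst :=
      Continuous.measurable (by fun_prop)
    have h2 : Measurable fun ω : BlockSphere d k => ω.1.snd :=
      Continuous.measurable (by fun_prop)
    exact ((h1.norm.pow_const _).sqrt.inv).mul ((h2.norm.pow_const _).sqrt.inv)
  rw [memLp_two_iff_integrable_sq hm.aestronglyMeasurable]
  refine (integrable_toSphere_inv_norm_pow_mul (integrableOn_inv_norm_pow (d - k))
    (integrableOn_inv_norm_pow k)).congr (.of_forall fun ω => ?_)
  simp only
  rw [mul_pow, inv_pow, inv_pow, Real.sq_sqrt (by positivity), Real.sq_sqrt (by positivity)]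

theorem exists_norm_sphereExtension_le (d k : ℕ) :
    ∃ C : ℝ, 0 ≤ C ∧ ∀ F : Lp ℂ 2 (surfaceMeasure d k), IsBlockSymmetric F →
      ∀ (y : EuclideanSpace ℝ (Fin (d - k))) (z : EuclideanSpace ℝ (Fin k)),
        ‖sphereExtension F (WithLp.toLp 2 (y, z))‖ ≤
          C * ‖F‖ * (1 + ‖y‖) ^ ((1 - ((d - k : ℕ) : ℝ)) / 2)
            * (1 + ‖z‖) ^ ((1 - (k : ℝ)) / 2) := by
  obtain ⟨C₁, hC₁, h₁⟩ := exists_averaging_measure (d - k)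
  obtain ⟨C₂, hC₂, h₂⟩ := exists_averaging_measure k
  have hw := memLp_inv_sqrt_norm_pow_mul d k
  refine ⟨C₁ * C₂ * ‖hw.toLp _‖, by positivity, fun F hF y z => ?_⟩
  obtain ⟨μ, hμp, hμ, hμb⟩ := h₁ y
  obtain ⟨ν, hνp, hν, hνb⟩ := h₂ z
  rw [hF.sphereExtension_eq hμ hν]
  set Y := (1 + ‖y‖) ^ ((1 - ((d - k : ℕ) : ℝ)) / 2) with hY
  set Z := (1 + ‖z‖) ^ ((1 - (k : ℝ)) / 2) with hZ
  have hY0 : 0 ≤ Y := by positivity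
  have hZ0 : 0 ≤ Z := by positivity
  -- The averaging bound must avoid u = 0 when N ≥ 2, because the weight is then `0⁻¹ = 0`; such ω
  -- form a null set.
  have hy0 : ∀ᵐ ω ∂(surfaceMeasure d k), d - k ≤ 1 ∨ ω.1.fst ≠ 0 := by
    by_cases h : d - k ≤ 1
    · exact .of_forall fun _ => Or.inl h
    · have : Nonempty (Fin (d - k)) := ⟨⟨0, by omega⟩⟩
      filter_upwards [ae_toSphere_fst_ne_zero] with ω hω using Or.inr hω
  have hz0 : ∀ᵐ ω ∂(surfaceMeasure d k), k ≤ 1 ∨ ω.1.snd ≠ 0 := by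
    by_cases h : k ≤ 1
    · exact .of_forall fun _ => Or.inl h
    · have : Nonempty (Fin k) := ⟨⟨0, by omega⟩⟩
      filter_upwards [ae_toSphere_snd_ne_zero] with ω hω using Or.inr hω
  have hFw : Integrable (fun ω => ‖F ω‖ * ((√(‖ω.1.fst‖ ^ (d - k - 1)))⁻¹ *
      (√(‖ω.1.snd‖ ^ (k - 1)))⁻¹)) (surfaceMeasure d k) :=
    (Lp.memLp F).norm.integrable_mul hw
  refine (norm_integral_le_of_norm_le (hFw.const_mul (C₁ * C₂ * Y * Z)) ?_).trans ?_
  · filter_upwards [hy0, hz0] with ω hω1 hω2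
    have hω : ‖ω.1‖ ^ 2 = 1 := by simp
    rw [WithLp.prod_norm_sq_eq_of_L2] at hω
    have hy1 : ‖ω.1.fst‖ ≤ 1 := by nlinarith [norm_nonneg ω.1.fst, sq_nonneg ‖ω.1.snd‖]
    have hz1 : ‖ω.1.snd‖ ≤ 1 := by nlinarith [norm_nonneg ω.1.snd, sq_nonneg ‖ω.1.fst‖]
    rw [norm_mul, norm_mul]
    calc _ ≤ ‖F ω‖ * ((C₁ * (√(‖ω.1.fst‖ ^ (d - k - 1)))⁻¹ * Y) *
          (C₂ * (√(‖ω.1.snd‖ ^ (k - 1)))⁻¹ * Z)) := by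
          gcongr
          · exact hμb _ hy1 hω1
          · exact hνb _ hz1 hω2
      _ = _ := by ring
  · rw [integral_const_mul]
    calc C₁ * C₂ * Y * Z * _ ≤ C₁ * C₂ * Y * Z * (‖F‖ * ‖hw.toLp _‖) := by
          gcongr
          exact integral_norm_mul_le_norm_mul_norm_toLp F hw
      _ = _ := by ring

/-- (1+s)(1+t) ≥ s + t ≥ x: decay of order 1/2 in each block suffices, even if one block stays
bounded. -/
theorem rpow_mul_rpow_le_inv_sqrt {s t x p q : ℝ} (hs : 0 ≤ s) (ht : 0 ≤ t) (hx : 0 < x)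
    (hxst : x ≤ s + t) (hp : p ≤ -(1 / 2)) (hq : q ≤ -(1 / 2)) :
    (1 + s) ^ p * (1 + t) ^ q ≤ (√x)⁻¹ := by
  calc (1 + s) ^ p * (1 + t) ^ q ≤ (1 + s) ^ (-(1 / 2 : ℝ)) * (1 + t) ^ (-(1 / 2 : ℝ)) := by
        gcongr <;> linarith
    _ = ((1 + s) * (1 + t)) ^ (-(1 / 2 : ℝ)) := (Real.mul_rpow (by linarith) (by linarith)).symm
    _ ≤ x ^ (-(1 / 2 : ℝ)) :=
        Real.rpow_le_rpow_of_nonpos hx (by nlinarith [mul_nonneg hs ht]) (by norm_num)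
    _ = (√x)⁻¹ := by rw [Real.rpow_neg hx.le, Real.sqrt_eq_rpow]

end
theorem mainTheorem6 (d k : ℕ) (hd : 1 ≤ d) (hk : k ≤ d) :
    (∃ C : ℝ, ∀ F : Lp ℂ 2 (surfaceMeasure d k), IsBlockSymmetric F →
      ∀ (y : EuclideanSpace ℝ (Fin (d - k))) (z : EuclideanSpace ℝ (Fin k)),
        ‖sphereExtension F (WithLp.toLp 2 (y, z))‖ ≤
          C * ‖F‖ * (1 + ‖y‖) ^ (((k : ℝ) + 1 - (d : ℝ)) / 2)
            * (1 + ‖z‖) ^ ((1 - (k : ℝ)) / 2)) ∧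
    (4 ≤ d → 2 ≤ k → k ≤ d - 2 →
      ∀ ε : ℝ, 0 < ε → ∃ R : ℝ, ∀ F : Lp ℂ 2 (surfaceMeasure d k), IsBlockSymmetric F →
        ‖F‖ = 1 → ∀ x : BlockSpace d k, R < ‖x‖ → ‖sphereExtension F x‖ < ε) := by
  obtain ⟨C, hC0, hC⟩ := exists_norm_sphereExtension_le d k
  refine ⟨⟨C, fun F hF y z => ?_⟩, fun hd4 hk2 hkd ε hε => ?_⟩
  · have he : ((k : ℝ) + 1 - (d : ℝ)) / 2 = (1 - ((d - k : ℕ) : ℝ)) / 2 := by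
      push_cast [hk]
      ring
    rw [he]
    exact hC F hF y z
  -- C |x|^(-1/2) < ε as soon as |x| > (C/ε)².
  · refine ⟨(C / ε) ^ 2, fun F hF hF1 x hx => ?_⟩
    have hx0 : 0 < ‖x‖ := (sq_nonneg _).trans_lt hx
    have hn : ‖x‖ ≤ ‖x.fst‖ + ‖x.snd‖ := by
      rw [WithLp.prod_norm_eq_of_L2]
      refine Real.sqrt_le_iff.2 ⟨by positivity, ?_⟩
      nlinarith [mul_nonneg (norm_nonneg x.fst) (norm_nonneg x.snd)]
    have h1 : (2 : ℝ) ≤ ((d - k : ℕ) : ℝ) := by exact_mod_cast (by omega : 2 ≤ d - k)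
    have h2 : (2 : ℝ) ≤ (k : ℝ) := by exact_mod_cast hk2
    have h3 := rpow_mul_rpow_le_inv_sqrt (norm_nonneg x.fst) (norm_nonneg x.snd) hx0 hn
      (p := (1 - ((d - k : ℕ) : ℝ)) / 2) (q := (1 - (k : ℝ)) / 2) (by linarith) (by linarith)
    have h4 : C / ε < √‖x‖ := Real.lt_sqrt_of_sq_lt hx
    have h5 := hC F hF x.fst x.snd
    rw [hF1, mul_one, mul_assoc] at h5
    calc ‖sphereExtension F x‖ ≤ C * (√‖x‖)⁻¹ := h5.trans (by gcongr)
      _ = C / √‖x‖ := rfl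
      _ < ε := by
        rw [div_lt_iff₀ (Real.sqrt_pos.2 hx0), mul_comm]
        exact (div_lt_iff₀ hε).1 h4
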